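/- Let $A\in\mathbb{R}^{M\times N}$ and $c\in\mathbb{R}^N$. There is a constant $\kappa\ge 0$, depending only on $A$ and $c$, with the following properties. If the dual feasible region $\{p\in\mathbb{R}^M : A^Tp\le c\}$ has an extreme point (for instance, if it is non-empty and $A$ has linearly independent rows), then $\kappa=\max\{\|p\| : p \text{ an extreme point of } \{A^Tp\le c\}\}$, where $\|\cdot\|$ is the Euclidean norm. Let $b\in\mathbb{R}^M$ be such that the linear program $\min\{c^Tx : Ax=b,\ x\ge 0\}$ has an optimal solution $x^*$. For $x\in\mathbb{R}^N$ and $\mathcal I\subseteq\mathcal N=\{1,\dots,N\}$ let $\mathcal D(x;\mathcal I)$ and $q(x;\mathcal I)$ be the set of minimizers and the optimal value of $$\min_{d\in\mathbb{R}^N}\{c^Td : x+d\ge 0,\ Ad=0,\ d_i=0\ \ \forall i\in\mathcal N\setminus\mathcal I\}.$$ Inexact random block coordinate descent: fix a batch size $l$ with $\operatorname{rank}(A)+1\le l\le N$ and sequences $\epsilon_k\ge0$, $\hat\epsilon_k\ge 0$. Start from $x^0$ with $Ax^0=b$, $x^0\ge0$ (deterministic, or random with $c^Tx^0$ integrable).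 For $k=0,1,2,\dots$, draw $\mathcal I_k$ uniformly from the subsets of $\mathcal N$ of cardinality $l$, independently of $(x^0,\dots,x^k)$; find $d^k$ such that $$c^Td^k\le(1-\epsilon_k)\,c^Td^k_*\ \ \forall d^k_*\in\mathcal D(x^k;\mathcal I_k),\qquad x^k+d^k\ge0,\qquad \|Ad^k\|\le\hat\epsilon_k,\qquad d^k_i=0\ \ \forall i\notin\mathcal I_k;$$ and set $x^{k+1}=x^k+d^k$. Let $\mathcal F_k$ be the $\sigma$-algebra generated by $x^0,\dots,x^k$. A constant $v\in(0,1]$ satisfies the expected Gauss-Southwell-$q$ rule if, for all $k\ge 0$, $\mathbb E[q(x^k;\mathcal I_k)\mid\mathcal F_k]\le v\,q(x^k;\mathcal N)$ almost surely. Let $\delta>0$ and suppose that $0\le\epsilon_k\le\epsilon<1$ for all $k$ and $\sum_{k=0}^\infty\hat\epsilon_k\le\delta$. Then: 1. almost surely, $\|Ax^k-b\|\le\delta$ and $x^k\ge0$ for all $k\ge0$; 2. almost surely, $c^Tx^k\ge c^Tx^*-\kappa\delta$ for all $k\ge0$; 3. the expected Gauss-Southwell-$q$ rule holds with $v=\dfrac{1}{\binom{N}{l}(N-l+1)}$;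 and for every $v\in(0,1]$ with which it holds and every $k\ge0$, $c^Tx^k$ is integrable and $$\mathbb E\big[c^Tx^k-(c^Tx^*+\kappa\delta)\big]\le\big(1-(1-\epsilon)v\big)^k\,\mathbb E\big[c^Tx^0-(c^Tx^*+\kappa\delta)\big].$$ -/

import Mathlib

open MeasureTheory ProbabilityTheory Matrix
open scoped ENNReal

namespace InexactRBCD

noncomputable section

/-- Feasible set `{x | A x = b, x ≥ 0}` of the standard linear program. -/
def lpFeasible {M N : ℕ} (A : Matrix (Fin M) (Fin N) ℝ) (b : Fin M → ℝ) : Set (Fin N → ℝ) :=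
  {x | A *ᵥ x = b ∧ 0 ≤ x}

/-- Set of optimal solutions of `min cᵀx` subject to `A x = b`, `x ≥ 0`. -/
def lpOptimal {M N : ℕ} (A : Matrix (Fin M) (Fin N) ℝ) (b : Fin M → ℝ) (c : Fin N → ℝ) :
    Set (Fin N → ℝ) :=
  {x | x ∈ lpFeasible A b ∧ ∀ y ∈ lpFeasible A b, c ⬝ᵥ x ≤ c ⬝ᵥ y}

/-- Feasible region `{p | Aᵀ p ≤ c}` of the dual program, in Euclidean space. -/
def dualFeasible {M N : ℕ} (A : Matrix (Fin M) (Fin N) ℝ) (c : Fin N → ℝ) :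
    Set (EuclideanSpace ℝ (Fin M)) :=
  {p | Aᵀ *ᵥ p.ofLp ≤ c}

/-- Feasible directions of the subproblem at `x` (not necessarily feasible for the linear program)
with working set `I`: `x + d ≥ 0`, `A d = 0` and `d` vanishes off `I`. -/
def subFeasible {M N : ℕ} (A : Matrix (Fin M) (Fin N) ℝ) (x : Fin N → ℝ) (I : Finset (Fin N)) :
    Set (Fin N → ℝ) :=
  {d | 0 ≤ x + d ∧ A *ᵥ d = 0 ∧ ∀ i, i ∉ I → d i = 0}

/-- The set `D(x; I)` of minimizers of `cᵀd` over the feasible directions. -/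
def subArgmin {M N : ℕ} (A : Matrix (Fin M) (Fin N) ℝ) (c : Fin N → ℝ) (x : Fin N → ℝ)
    (I : Finset (Fin N)) : Set (Fin N → ℝ) :=
  {d | d ∈ subFeasible A x I ∧ ∀ e ∈ subFeasible A x I, c ⬝ᵥ d ≤ c ⬝ᵥ e}

/-- The optimal value `q(x; I)` of the subproblem. -/
def subValue {M N : ℕ} (A : Matrix (Fin M) (Fin N) ℝ) (c : Fin N → ℝ) (x : Fin N → ℝ)
    (I : Finset (Fin N)) : ℝ :=
  sInf ((fun d => c ⬝ᵥ d) '' subFeasible A x I)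

/-- The requirements on an inexact solution `d` of the subproblem at `x` with working set `I`,
for the tolerances `ε` (objective) and `ε'` (infeasibility, in the Euclidean norm). -/
def IsInexactStep {M N : ℕ} (A : Matrix (Fin M) (Fin N) ℝ) (c : Fin N → ℝ) (ε ε' : ℝ)
    (x : Fin N → ℝ) (I : Finset (Fin N)) (d : Fin N → ℝ) : Prop :=
  (∀ e ∈ subArgmin A c x I, c ⬝ᵥ d ≤ (1 - ε) * (c ⬝ᵥ e)) ∧
    0 ≤ x + d ∧ ‖WithLp.toLp 2 (A *ᵥ d)‖ ≤ ε' ∧ ∀ i, i ∉ I → d i = 0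

/-- The sigma-algebra generated by `x⁰, …, xᵏ`. -/
abbrev history {N : ℕ} {Ω : Type*} (x : ℕ → Ω → Fin N → ℝ) (k : ℕ) : MeasurableSpace Ω :=
  ⨆ j ≤ k, MeasurableSpace.comap (x j) inferInstance

/-- `x` (iterates), `d` (directions), `I` (working sets) form a run of inexact random block
coordinate descent with batch size `l` and inexactness sequences `ε`, `ε'`, on the probability
space `(Ω, P)`. The starting point may be random. -/
structure IsRun {M N : ℕ} (A : Matrix (Fin M) (Fin N) ℝ) (b : Fin M → ℝ) (c : Fin N → ℝ)
    (l : ℕ) (ε ε' : ℕ → ℝ) {Ω : Type*} [MeasurableSpace Ω] (P : Measure Ω)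
    (x d : ℕ → Ω → Fin N → ℝ) (I : ℕ → Ω → Finset (Fin N)) : Prop where
  rank_lt : A.rank + 1 ≤ l
  le_dim : l ≤ N
  measurable_x : ∀ k, Measurable (x k)
  measurable_I : ∀ k S, MeasurableSet {ω | I k ω = S}
  init_feasible : ∀ᵐ ω ∂P, x 0 ω ∈ lpFeasible A b
  init_integrable : Integrable (fun ω => c ⬝ᵥ x 0 ω) P
  /-- `I_k` is uniformly distributed on the subsets of size `l`. -/
  uniform : ∀ k, ∀ S : Finset (Fin N), S.card = l → P {ω | I k ω = S} = (N.choose l : ℝ≥0∞)⁻¹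
  /-- `I_k` is drawn independently of `x⁰, …, xᵏ`. -/
  indep : ∀ k, Indep (MeasurableSpace.comap (I k) ⊤) (history x k) P
  inexact : ∀ k, ∀ᵐ ω ∂P, IsInexactStep A c (ε k) (ε' k) (x k ω) (I k ω) (d k ω)
  update : ∀ k ω, x (k + 1) ω = x k ω + d k ω

/-- The expected Gauss-Southwell-q rule with constant `v ∈ (0, 1]`:
`E[q(xᵏ; I_k) | x⁰, …, xᵏ] ≤ v q(xᵏ; {1, …, N})` almost surely, for all `k`. -/
def ExpectedGSq {M N : ℕ} (A : Matrix (Fin M) (Fin N) ℝ) (c : Fin N → ℝ)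
    {Ω : Type*} [MeasurableSpace Ω] (P : Measure Ω)
    (x : ℕ → Ω → Fin N → ℝ) (I : ℕ → Ω → Finset (Fin N)) (v : ℝ) : Prop :=
  0 < v ∧ v ≤ 1 ∧ ∀ k, P[fun ω => subValue A c (x k ω) (I k ω) | history x k] ≤ᵐ[P]
    fun ω => v * subValue A c (x k ω) Finset.univ

end

end InexactRBCD

/-! For `x ≥ 0` the full subproblem is the linear program with right-hand side `A x`, shifted by
`x`: q(x; N) is the optimal value at `A x` minus c·x. Optimal values are attained at dual extreme
points, and the dual polyhedron does not involve the right-hand side. By Cauchy–Schwarz the optimal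
values at `A x` and at `b` therefore differ by at most κ‖Ax − b‖, and the residuals of the iterates
are bounded by the summed tolerances. This gives the lower bound on c·xᵏ (`sub_le_objective`) and
q(x; N) ≤ c·x* + κδ − c·x (`subValue_univ_le_gap`). Combined with the Gauss-Southwell rule and the
inexact decrease, the latter contracts the expected gap by the factor 1 − (1 − ε)v.

For the explicit v, a minimizer of the full subproblem lies in the kernel of A and splits, without
sign cancellation, into at most N − l + 1 kernel vectors of support at most l
(`exists_between_small_support`). The best of them is a feasible direction with an average share of
the decrease, and some batch containing its support is drawn with probability 1 / C(N, l).

The dual polyhedron may contain lines, so extreme points are taken in its part orthogonal to the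
kernel of Aᵀ (`dualPointed`). Extreme points also make q(·; I) a maximum of finitely many linear
functions, hence measurable. -/

namespace InexactRBCD

/-! ### Farkas' lemma and linear programming duality -/

/-- **Farkas' lemma** for finitely many linear functionals on a real vector space. -/
theorem exists_nonneg_combination {V ι : Type*} [AddCommGroup V] [Module ℝ V] (s : Finset ι)
    (a : ι → V →ₗ[ℝ] ℝ) (γ : V →ₗ[ℝ] ℝ) (h : ∀ x, (∀ i ∈ s, a i x ≤ 0) → γ x ≤ 0) :
    ∃ w : ι → ℝ, (∀ i, 0 ≤ w i) ∧ ∀ x, γ x = ∑ i ∈ s, w i * a i x := by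
  classical
  induction s using Finset.induction_on generalizing a γ with
  | empty =>
    refine ⟨0, fun _ => le_rfl, fun x => ?_⟩
    have h1 := h x (by simp)
    have h2 := h (-x) (by simp)
    simp only [map_neg] at h2
    simp only [Finset.sum_empty]
    linarith
  | insert k s hk ih =>
    by_cases hs : ∀ x, (∀ i ∈ s, a i x ≤ 0) → γ x ≤ 0
    · obtain ⟨w, hw, hγ⟩ := ih a γ hs
      refine ⟨fun i => if i = k then 0 else w i, fun i => ?_, fun x => ?_⟩
      · dsimp only
        split_ifs
        exacts [le_rfl, hw i]
      · rw [Finset.sum_insert hk, hγ x]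
        simp only [if_true, zero_mul, zero_add]
        exact Finset.sum_congr rfl fun i hi => by rw [if_neg (ne_of_mem_of_not_mem hi hk)]
    · push Not at hs
      obtain ⟨z, hz, hγz⟩ := hs
      have hkz : 0 < a k z := by
        by_contra hneg
        refine absurd (h z fun i hi => ?_) (not_le.2 hγz)
        rcases Finset.mem_insert.1 hi with rfl | hi
        exacts [not_lt.1 hneg, hz i hi]
      -- Composing every functional with the projection along `z` onto the kernel of `a k`
      -- eliminates `a k`.
      obtain ⟨w, hw, hγ⟩ := ih (fun i => a i - (a i z / a k z) • a k)
        (γ - (γ z / a k z) • a k) (fun x hx => by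
          have := h (x - (a k x / a k z) • z) (fun i hi => by
            rcases Finset.mem_insert.1 hi with rfl | hi
            · simp [hkz.ne']
            · have := hx i hi
              simp only [LinearMap.sub_apply, LinearMap.smul_apply, smul_eq_mul, map_sub,
                map_smul] at this ⊢
              calc _ = _ := by ring
                _ ≤ 0 := this)
          simp only [LinearMap.sub_apply, LinearMap.smul_apply, smul_eq_mul, map_sub,
            map_smul] at this ⊢
          calc _ = _ := by ring
            _ ≤ 0 := this)
      refine ⟨fun i => if i = k then (γ z - ∑ j ∈ s, w j * a j z) / a k z else w i,
        fun i => ?_, fun x => ?_⟩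
      · dsimp only
        split_ifs
        · refine div_nonneg ?_ hkz.le
          have : ∑ j ∈ s, w j * a j z ≤ 0 :=
            Finset.sum_nonpos fun j hj => mul_nonpos_of_nonneg_of_nonpos (hw j) (hz j hj)
          linarith
        · exact hw i
      · have h1 := hγ x
        simp only [LinearMap.sub_apply, LinearMap.smul_apply, smul_eq_mul] at h1
        have h2 : ∑ i ∈ s, (if i = k then (γ z - ∑ j ∈ s, w j * a j z) / a k z else w i) * a i x
            = ∑ i ∈ s, w i * a i x :=
          Finset.sum_congr rfl fun i hi => by rw [if_neg (ne_of_mem_of_not_mem hi hk)]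
        have h3 : ∑ i ∈ s, w i * (a i x - a i z / a k z * a k x)
            = ∑ i ∈ s, w i * a i x - (∑ i ∈ s, w i * a i z) / a k z * a k x := by
          rw [Finset.sum_div, Finset.sum_mul, ← Finset.sum_sub_distrib]
          exact Finset.sum_congr rfl fun i _ => by ring
        rw [h3] at h1
        rw [Finset.sum_insert hk, h2]
        dsimp only
        rw [if_pos rfl]
        have h4 : γ x = ∑ i ∈ s, w i * a i x - (∑ i ∈ s, w i * a i z) / a k z * a k x
          + γ z / a k z * a k x := by linarith
        rw [h4]
        ring

variable {M N : ℕ} {A : Matrix (Fin M) (Fin N) ℝ} {b : Fin M → ℝ} {c : Fin N → ℝ}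

/-- The linear functional `(p, τ) ↦ a ⬝ᵥ p + t * τ`. -/
def pairing (a : Fin M → ℝ) (t : ℝ) : ((Fin M → ℝ) × ℝ) →ₗ[ℝ] ℝ where
  toFun z := a ⬝ᵥ z.1 + t * z.2
  map_add' z z' := by simp only [Prod.fst_add, Prod.snd_add, dotProduct_add]; ring
  map_smul' r z := by
    simp only [Prod.smul_fst, Prod.smul_snd, dotProduct_smul, smul_eq_mul, RingHom.id_apply]; ring

theorem pairing_apply (a : Fin M → ℝ) (t : ℝ) (p : Fin M → ℝ) (τ : ℝ) :
    pairing a t (p, τ) = a ⬝ᵥ p + t * τ := rfl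

theorem mulVec_dotProduct (x : Fin N → ℝ) (p : Fin M → ℝ) : A *ᵥ x ⬝ᵥ p = (Aᵀ *ᵥ p) ⬝ᵥ x := by
  rw [dotProduct_comm, dotProduct_mulVec, mulVec_transpose]

theorem dotProduct_mono_left {u v y : Fin N → ℝ} (hy : 0 ≤ y) (h : u ≤ v) : u ⬝ᵥ y ≤ v ⬝ᵥ y :=
  Finset.sum_le_sum fun j _ => mul_le_mul_of_nonneg_right (h j) (hy j)

theorem weak_duality {y : Fin N → ℝ} {p : Fin M → ℝ} (hy : y ∈ lpFeasible A b)
    (hp : Aᵀ *ᵥ p ≤ c) : b ⬝ᵥ p ≤ c ⬝ᵥ y := by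
  rw [← hy.1, mulVec_dotProduct]
  exact dotProduct_mono_left hy.2 hp

theorem mulVec_apply_eq_sum (A : Matrix (Fin M) (Fin N) ℝ) (y : Fin N → ℝ) (i : Fin M) :
    (A *ᵥ y) i = ∑ j, y j * A i j := by
  simp only [mulVec, dotProduct, mul_comm]

/-- A feasible linear program with feasible dual has an optimal solution. -/
theorem exists_mem_lpOptimal {x : Fin N → ℝ} {p : Fin M → ℝ} (hx : x ∈ lpFeasible A b)
    (hp : Aᵀ *ᵥ p ≤ c) : ∃ y, y ∈ lpOptimal A b c := by
  set D : Set ℝ := (fun p => b ⬝ᵥ p) '' {p | Aᵀ *ᵥ p ≤ c} with hD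
  have hne : D.Nonempty := ⟨_, p, hp, rfl⟩
  have hbdd : BddAbove D := ⟨c ⬝ᵥ x, by rintro _ ⟨q, hq, rfl⟩; exact weak_duality hx hq⟩
  -- Homogenized dual: Aᵀq + τc ≤ 0 and τ ≤ 0 force b·q + τ sup D ≤ 0, by rescaling `q` if τ < 0 and
  -- by the primal point `x` if τ = 0. The multipliers form a primal feasible point of cost at most
  -- sup D.
  obtain ⟨w, hw, h⟩ := exists_nonneg_combination (Finset.univ : Finset (Option (Fin N)))
    (fun o => o.elim (pairing 0 1) fun j => pairing (fun i => A i j) (c j)) (pairing b (sSup D))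
    (by
      rintro ⟨q, τ⟩ hq
      have hτ : τ ≤ 0 := by simpa [pairing_apply] using hq none (Finset.mem_univ _)
      have hqj : ∀ j, (Aᵀ *ᵥ q) j + c j * τ ≤ 0 := fun j => hq (some j) (Finset.mem_univ _)
      rw [pairing_apply]
      rcases hτ.lt_or_eq with hτ | rfl
      · have h1 : b ⬝ᵥ ((-τ)⁻¹ • q) ≤ sSup D := le_csSup hbdd ⟨_, fun j => by
          rw [mulVec_smul, Pi.smul_apply, smul_eq_mul, inv_mul_le_iff₀ (by linarith)]
          linarith [hqj j], rfl⟩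
        rw [dotProduct_smul, smul_eq_mul, inv_mul_le_iff₀ (by linarith)] at h1
        linarith
      · rw [← hx.1, mulVec_dotProduct, mul_zero, add_zero]
        have := dotProduct_mono_left (u := Aᵀ *ᵥ q) (v := 0) hx.2
          (fun j => by simpa using hqj j)
        simpa using this)
  simp only [Fintype.sum_option, Option.elim] at h
  refine ⟨fun j => w (some j), ⟨funext fun i => ?_, fun j => hw _⟩, fun y hy => ?_⟩
  · have := h (Pi.single i 1, 0)
    simp only [pairing_apply, dotProduct_single, mul_zero, mul_one, add_zero] at this
    rw [this, mulVec_apply_eq_sum, Pi.zero_apply, mul_zero, zero_add]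
  · have h1 := h (0, 1)
    simp only [pairing_apply, dotProduct_zero, mul_one, zero_add] at h1
    have h2 : sSup D ≤ c ⬝ᵥ y :=
      csSup_le hne (by rintro _ ⟨q, hq, rfl⟩; exact weak_duality hy hq)
    have h3 : c ⬝ᵥ (fun j => w (some j)) = ∑ j, w (some j) * c j :=
      Finset.sum_congr rfl fun j _ => mul_comm _ _
    linarith [hw none]

/-- **Strong duality**: an optimal solution of a linear program has a dual certificate. -/
theorem exists_dual_certificate {x : Fin N → ℝ} (hx : x ∈ lpOptimal A b c) :
    ∃ p : Fin M → ℝ, Aᵀ *ᵥ p ≤ c ∧ b ⬝ᵥ p = c ⬝ᵥ x := by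
  by_cases hex : ∃ (q : Fin M → ℝ) (τ : ℝ), 0 < τ ∧ (∀ j, (Aᵀ *ᵥ q) j - c j * τ ≤ 0) ∧
      c ⬝ᵥ x * τ ≤ b ⬝ᵥ q
  · obtain ⟨q, τ, hτ, hq, hb⟩ := hex
    have hfeas : Aᵀ *ᵥ (τ⁻¹ • q) ≤ c := fun j => by
      rw [mulVec_smul, Pi.smul_apply, smul_eq_mul, inv_mul_le_iff₀ hτ]
      linarith [hq j]
    refine ⟨τ⁻¹ • q, hfeas, le_antisymm (weak_duality hx.1 hfeas) ?_⟩
    rw [dotProduct_smul, smul_eq_mul, le_inv_mul_iff₀ hτ]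
    linarith
  · exfalso
    obtain ⟨w, hw, h⟩ := exists_nonneg_combination (Finset.univ : Finset (Option (Fin N)))
      (fun o => o.elim (pairing (-b) (c ⬝ᵥ x)) fun j => pairing (fun i => A i j) (-c j))
      (pairing 0 1) (by
        rintro ⟨q, τ⟩ hq
        have h0 : -b ⬝ᵥ q + c ⬝ᵥ x * τ ≤ 0 := hq none (Finset.mem_univ _)
        have hqj : ∀ j, (Aᵀ *ᵥ q) j + -c j * τ ≤ 0 := fun j => hq (some j) (Finset.mem_univ _)
        rw [pairing_apply, zero_dotProduct, one_mul, zero_add]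
        by_contra hτ
        refine hex ⟨q, τ, not_le.1 hτ, fun j => by linarith [hqj j], ?_⟩
        rw [neg_dotProduct] at h0
        linarith)
    simp only [Fintype.sum_option, Option.elim] at h
    set μ := w none
    set y : Fin N → ℝ := fun j => w (some j)
    have hy : 0 ≤ y := fun j => hw _
    have hAy : A *ᵥ y = μ • b := funext fun i => by
      have := h (Pi.single i 1, 0)
      simp only [pairing_apply, dotProduct_single, mul_zero, mul_one, add_zero,
        Pi.neg_apply, Pi.zero_apply] at this
      rw [Pi.smul_apply, smul_eq_mul, mulVec_apply_eq_sum]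
      linarith
    have hcy : c ⬝ᵥ y = μ * (c ⬝ᵥ x) - 1 := by
      have h1 := h (0, 1)
      simp only [pairing_apply, dotProduct_zero, mul_one, zero_add, mul_neg,
        Finset.sum_neg_distrib] at h1
      have h3 : c ⬝ᵥ y = ∑ j, w (some j) * c j :=
        Finset.sum_congr rfl fun j _ => mul_comm _ _
      linarith
    have hμ1 : (0 : ℝ) < μ + 1 := by linarith [hw none]
    -- A feasible point of cost c·x − 1/(μ + 1). Including `x` in the average also covers μ = 0,
    -- where `y` is only a recession direction.
    have := hx.2 ((μ + 1)⁻¹ • (x + y)) ⟨by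
      rw [mulVec_smul, mulVec_add, hAy, hx.1.1, inv_smul_eq_iff₀ hμ1.ne', add_smul, one_smul,
        add_comm], smul_nonneg (inv_nonneg.2 hμ1.le) (add_nonneg hx.1.2 hy)⟩
    rw [dotProduct_smul, smul_eq_mul, dotProduct_add, hcy, le_inv_mul_iff₀ hμ1] at this
    linarith

end InexactRBCD

/-! ### Extreme points of the dual polyhedron -/

namespace InexactRBCD

/-- Ratio test: a step along `h` until the first of the slacks `g` is exhausted. -/
theorem exists_max_step {ι : Type*} [Fintype ι] {g h : ι → ℝ} (hg : 0 ≤ g)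
    (hh : ∀ j, g j = 0 → h j = 0) (hpos : ∃ j, 0 < h j) :
    ∃ t, 0 < t ∧ (∀ j, t * h j ≤ g j) ∧ ∃ j, g j ≠ 0 ∧ t * h j = g j := by
  classical
  obtain ⟨j, hj, hmin⟩ := (Finset.univ.filter fun j => 0 < h j).exists_min_image
    (fun j => g j / h j) (by simpa [Finset.Nonempty] using hpos)
  simp only [Finset.mem_filter, Finset.mem_univ, true_and] at hj hmin
  have hgj : g j ≠ 0 := fun h0 => hj.ne' (hh j h0)
  have ht : 0 < g j / h j := div_pos ((hg j).lt_of_ne' hgj) hj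
  refine ⟨g j / h j, ht, fun i => ?_, j, hgj, div_mul_cancel₀ _ hj.ne'⟩
  rcases lt_or_ge 0 (h i) with hi | hi
  · exact (le_div_iff₀ hi).1 (hmin i hi)
  · exact (mul_nonpos_of_nonneg_of_nonpos ht.le hi).trans (hg i)

theorem exists_two_sided_step {ι : Type*} [Fintype ι] {g h : ι → ℝ} (hg : 0 ≤ g)
    (hh : ∀ j, g j = 0 → h j = 0) : ∃ t, 0 < t ∧ ∀ j, |t * h j| ≤ g j := by
  by_cases h0 : ∃ j, 0 < |h j|
  · obtain ⟨t, ht, hle, -⟩ := exists_max_step (h := fun j => |h j|) hg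
      (fun j hj => by simp [hh j hj]) h0
    exact ⟨t, ht, fun j => by rw [abs_mul, abs_of_pos ht]; exact hle j⟩
  · push Not at h0
    exact ⟨1, one_pos, fun j => by rw [one_mul]; exact (h0 j).trans (hg j)⟩

variable {M N : ℕ} {A : Matrix (Fin M) (Fin N) ℝ} {b : Fin M → ℝ} {c : Fin N → ℝ}

/-- The dual feasible points orthogonal to the kernel of `Aᵀ`. -/
def dualPointed (A : Matrix (Fin M) (Fin N) ℝ) (c : Fin N → ℝ) :
    Set (EuclideanSpace ℝ (Fin M)) :=
  {p | p ∈ dualFeasible A c ∧ ∀ u : EuclideanSpace ℝ (Fin M), Aᵀ *ᵥ u.ofLp = 0 → inner ℝ u p = 0}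

theorem add_smul_mem_dualPointed {p u : EuclideanSpace ℝ (Fin M)} {t : ℝ}
    (hp : p ∈ dualPointed A c)
    (hu : ∀ v : EuclideanSpace ℝ (Fin M), Aᵀ *ᵥ v.ofLp = 0 → inner ℝ v u = 0)
    (h : ∀ j, t * (Aᵀ *ᵥ u.ofLp) j ≤ c j - (Aᵀ *ᵥ p.ofLp) j) : p + t • u ∈ dualPointed A c := by
  refine ⟨fun j => ?_, fun v hv => ?_⟩
  · rw [WithLp.ofLp_add, WithLp.ofLp_smul, mulVec_add, mulVec_smul, Pi.add_apply, Pi.smul_apply,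
      smul_eq_mul]
    linarith [h j]
  · rw [inner_add_right, inner_smul_right, hp.2 v hv, hu v hv, mul_zero, add_zero]

theorem exists_add_sub_mem_dualPointed {p u : EuclideanSpace ℝ (Fin M)} (hp : p ∈ dualPointed A c)
    (hu : ∀ v : EuclideanSpace ℝ (Fin M), Aᵀ *ᵥ v.ofLp = 0 → inner ℝ v u = 0)
    (h : ∀ j, (Aᵀ *ᵥ p.ofLp) j = c j → (Aᵀ *ᵥ u.ofLp) j = 0) :
    ∃ t : ℝ, 0 < t ∧ p + t • u ∈ dualPointed A c ∧ p + (-t) • u ∈ dualPointed A c := by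
  obtain ⟨t, ht, hle⟩ := exists_two_sided_step (g := c - Aᵀ *ᵥ p.ofLp) (h := Aᵀ *ᵥ u.ofLp)
    (sub_nonneg.2 hp.1) (fun j hj => h j (by rw [Pi.sub_apply] at hj; linarith))
  refine ⟨t, ht, add_smul_mem_dualPointed hp hu fun j => (le_abs_self _).trans (hle j),
    add_smul_mem_dualPointed hp hu fun j => ?_⟩
  rw [neg_mul]
  exact (neg_le_abs _).trans (hle j)

/-- A point is extreme iff its active constraints determine it. -/
theorem mem_extremePoints_dualPointed_iff {p : EuclideanSpace ℝ (Fin M)} :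
    p ∈ (dualPointed A c).extremePoints ℝ ↔ p ∈ dualPointed A c ∧
      ∀ u : EuclideanSpace ℝ (Fin M),
        (∀ v : EuclideanSpace ℝ (Fin M), Aᵀ *ᵥ v.ofLp = 0 → inner ℝ v u = 0) →
        (∀ j, (Aᵀ *ᵥ p.ofLp) j = c j → (Aᵀ *ᵥ u.ofLp) j = 0) → u = 0 := by
  constructor
  · rintro hp
    refine ⟨hp.1, fun u hu h => ?_⟩
    obtain ⟨t, ht, h1, h2⟩ := exists_add_sub_mem_dualPointed hp.1 hu h
    have := hp.2 h1 h2 ⟨1 / 2, 1 / 2, by norm_num, by norm_num, by norm_num, by module⟩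
    have h3 : t • u = 0 := by simpa using this
    exact (smul_eq_zero.1 h3).resolve_left ht.ne'
  · rintro ⟨hp, h⟩
    refine mem_extremePoints_iff_left.2 ⟨hp, ?_⟩
    rintro p₁ h₁ p₂ h₂ ⟨r, s, hr, hs, hrs, hrsp⟩
    refine sub_eq_zero.1 (h (p₁ - p) (fun v hv => ?_) fun j hj => ?_)
    · rw [inner_sub_right, h₁.2 v hv, hp.2 v hv, sub_zero]
    · have h1 := h₁.1 j
      have h2 := h₂.1 j
      rw [WithLp.ofLp_sub, mulVec_sub, Pi.sub_apply, hj]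
      rw [← hrsp, WithLp.ofLp_add, WithLp.ofLp_smul, WithLp.ofLp_smul, mulVec_add, mulVec_smul,
        mulVec_smul, Pi.add_apply, Pi.smul_apply, Pi.smul_apply, smul_eq_mul, smul_eq_mul] at hj
      have h3 := mul_nonneg hr.le (sub_nonneg.2 h1)
      have h4 := mul_nonneg hs.le (sub_nonneg.2 h2)
      have h5 : r * (c j - (Aᵀ *ᵥ p₁.ofLp) j) = 0 := by
        have : r * c j + s * c j = c j := by rw [← add_mul, hrs, one_mul]
        linarith
      have := (mul_eq_zero.1 h5).resolve_left hr.ne'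
      linarith

/-- An extreme point is determined by its set of active constraints, and there are finitely many
such sets. -/
theorem finite_extremePoints_dualPointed (A : Matrix (Fin M) (Fin N) ℝ) (c : Fin N → ℝ) :
    ((dualPointed A c).extremePoints ℝ).Finite := by
  refine Set.Finite.of_finite_image (f := fun p => {j | (Aᵀ *ᵥ p.ofLp) j = c j})
    (Set.toFinite _) fun p hp q hq hpq => ?_
  rw [mem_extremePoints_dualPointed_iff] at hp
  refine (sub_eq_zero.1 (hp.2 (q - p) (fun v hv => ?_) fun j hj => ?_)).symm
  · rw [inner_sub_right, hq.1.2 v hv, hp.1.2 v hv, sub_zero]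
  · have : (Aᵀ *ᵥ q.ofLp) j = c j := (Set.ext_iff.1 hpq j).1 hj
    rw [WithLp.ofLp_sub, mulVec_sub, Pi.sub_apply, hj, this, sub_self]

theorem dotProduct_ofLp_add_smul (p u : EuclideanSpace ℝ (Fin M)) (t : ℝ) :
    b ⬝ᵥ (p + t • u).ofLp = b ⬝ᵥ p.ofLp + t * (b ⬝ᵥ u.ofLp) := by
  rw [WithLp.ofLp_add, WithLp.ofLp_smul, dotProduct_add, dotProduct_smul, smul_eq_mul]

/-- Induction on the number of slack constraints. A maximizer that is not extreme can move both ways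
along some `u` preserving the active constraints, so b·u = 0; moving until another constraint
becomes active keeps it a maximizer. -/
theorem exists_extremePoint_of_isMax (p : EuclideanSpace ℝ (Fin M)) (hp : p ∈ dualPointed A c)
    (hmax : ∀ q ∈ dualPointed A c, b ⬝ᵥ q.ofLp ≤ b ⬝ᵥ p.ofLp) :
    ∃ q ∈ (dualPointed A c).extremePoints ℝ, b ⬝ᵥ q.ofLp = b ⬝ᵥ p.ofLp := by
  classical
  induction hn : (Finset.univ.filter fun j => (Aᵀ *ᵥ p.ofLp) j ≠ c j).card using
    Nat.strong_induction_on generalizing p with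
  | _ n ih =>
    by_cases hext : p ∈ (dualPointed A c).extremePoints ℝ
    · exact ⟨p, hext, rfl⟩
    have hu' : ∃ u : EuclideanSpace ℝ (Fin M),
        (∀ v : EuclideanSpace ℝ (Fin M), Aᵀ *ᵥ v.ofLp = 0 → inner ℝ v u = 0) ∧
        (∀ j, (Aᵀ *ᵥ p.ofLp) j = c j → (Aᵀ *ᵥ u.ofLp) j = 0) ∧ ∃ j, 0 < (Aᵀ *ᵥ u.ofLp) j := by
      rw [mem_extremePoints_dualPointed_iff] at hext
      push Not at hext
      obtain ⟨u, hu, hact, hne⟩ := hext hp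
      -- Orthogonality of `u` to the kernel of Aᵀ enters here: up to sign, some slack shrinks along
      -- `u`, so the move is blocked eventually.
      have hne' : Aᵀ *ᵥ u.ofLp ≠ 0 := fun h0 => hne (inner_self_eq_zero.1 (hu u h0))
      obtain ⟨j, hj⟩ := Function.ne_iff.1 hne'
      rcases lt_or_gt_of_ne hj with hj | hj
      · refine ⟨-u, fun v hv => by rw [inner_neg_right, hu v hv, neg_zero], fun i hi => ?_, j, ?_⟩
        · rw [WithLp.ofLp_neg, mulVec_neg, Pi.neg_apply, hact i hi, neg_zero]
        · rw [WithLp.ofLp_neg, mulVec_neg, Pi.neg_apply]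
          simpa using hj
      · exact ⟨u, hu, hact, j, hj⟩
    obtain ⟨u, hu, hact, hpos⟩ := hu'
    have hbu : b ⬝ᵥ u.ofLp = 0 := by
      obtain ⟨t, ht, h1, h2⟩ := exists_add_sub_mem_dualPointed hp hu hact
      have h3 := hmax _ h1
      have h4 := hmax _ h2
      rw [dotProduct_ofLp_add_smul] at h3 h4
      have h5 : t * (b ⬝ᵥ u.ofLp) = 0 := by linarith
      exact (mul_eq_zero.1 h5).resolve_left ht.ne'
    obtain ⟨t, ht, hle, i, hi, hi'⟩ := exists_max_step (g := c - Aᵀ *ᵥ p.ofLp)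
      (h := Aᵀ *ᵥ u.ofLp) (sub_nonneg.2 hp.1)
      (fun j hj => hact j (by rw [Pi.sub_apply] at hj; linarith)) hpos
    have hb : b ⬝ᵥ (p + t • u).ofLp = b ⬝ᵥ p.ofLp := by
      rw [dotProduct_ofLp_add_smul, hbu, mul_zero, add_zero]
    have hlt : (Finset.univ.filter fun j => (Aᵀ *ᵥ (p + t • u).ofLp) j ≠ c j).card < n := by
      have hA : ∀ j, (Aᵀ *ᵥ (p + t • u).ofLp) j
          = (Aᵀ *ᵥ p.ofLp) j + t * (Aᵀ *ᵥ u.ofLp) j := fun j => by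
        rw [WithLp.ofLp_add, WithLp.ofLp_smul, mulVec_add, mulVec_smul, Pi.add_apply,
          Pi.smul_apply, smul_eq_mul]
      rw [← hn]
      rw [Pi.sub_apply] at hi hi'
      refine Finset.card_lt_card ⟨fun j hj => ?_, fun hsub => ?_⟩
      · simp only [Finset.mem_filter, Finset.mem_univ, true_and, hA] at hj ⊢
        exact fun h0 => hj (by rw [hact j h0, h0, mul_zero, add_zero])
      · have := (Finset.mem_filter.1 (hsub (Finset.mem_filter.2
          ⟨Finset.mem_univ i, fun h0 => hi (by linarith)⟩))).2
        rw [hA] at this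
        exact this (by linarith)
    obtain ⟨q, hq, hqb⟩ := ih _ hlt (p + t • u) (add_smul_mem_dualPointed hp hu hle)
      (fun q hq => (hmax q hq).trans_eq hb.symm) rfl
    exact ⟨q, hq, hqb.trans hb⟩

/-- A feasible linear program with feasible dual has an optimal solution and a dual optimal
solution that is an extreme point of the pointed part of the dual feasible region. -/
theorem exists_optimal_pair {x : Fin N → ℝ} {p : Fin M → ℝ} (hx : x ∈ lpFeasible A b)
    (hp : Aᵀ *ᵥ p ≤ c) : ∃ y ∈ lpOptimal A b c, ∃ q ∈ (dualPointed A c).extremePoints ℝ,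
      c ⬝ᵥ y = b ⬝ᵥ q.ofLp := by
  obtain ⟨y, hy⟩ := exists_mem_lpOptimal hx hp
  obtain ⟨r, hr, hry⟩ := exists_dual_certificate hy
  let K : Submodule ℝ (EuclideanSpace ℝ (Fin M)) :=
    LinearMap.ker (Matrix.mulVecLin Aᵀ ∘ₗ (WithLp.linearEquiv 2 ℝ (Fin M → ℝ)).toLinearMap)
  have hK : ∀ v : EuclideanSpace ℝ (Fin M), v ∈ K ↔ Aᵀ *ᵥ v.ofLp = 0 := fun v => Iff.rfl
  obtain ⟨k, hk, s, hs, hks⟩ := K.exists_add_mem_mem_orthogonal (WithLp.toLp 2 r)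
  have hA : Aᵀ *ᵥ s.ofLp = Aᵀ *ᵥ r := by
    have : r = k.ofLp + s.ofLp := by rw [← WithLp.ofLp_add, ← hks]
    rw [this, mulVec_add, (hK k).1 hk, zero_add]
  have hsmem : s ∈ dualPointed A c := by
    refine ⟨?_, fun v hv => (K.mem_orthogonal s).1 hs v ((hK v).2 hv)⟩
    change Aᵀ *ᵥ s.ofLp ≤ c
    rwa [hA]
  -- As b = A y is orthogonal to the kernel of Aᵀ, the projection preserves the dual value.
  have hbs : b ⬝ᵥ s.ofLp = c ⬝ᵥ y := by
    rw [← hry, ← hy.1.1, mulVec_dotProduct y s.ofLp, mulVec_dotProduct y r, hA]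
  obtain ⟨q, hq, hqs⟩ := exists_extremePoint_of_isMax (b := b) s hsmem
    (fun q hq => hbs ▸ weak_duality hy.1 hq.1)
  exact ⟨y, hy, q, hq, by rw [hqs, hbs]⟩

/-- An extreme point excludes lines, so the kernel of Aᵀ is trivial and the orthogonality condition
is void. -/
theorem dualPointed_eq_dualFeasible (h : ((dualFeasible A c).extremePoints ℝ).Nonempty) :
    dualPointed A c = dualFeasible A c := by
  obtain ⟨p, hp⟩ := h
  refine Set.ext fun q => ⟨fun hq => hq.1, fun hq => ⟨hq, fun u hu => ?_⟩⟩
  have hmem : ∀ t : ℝ, p + t • u ∈ dualFeasible A c := fun t => by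
    change Aᵀ *ᵥ (p + t • u).ofLp ≤ c
    rw [WithLp.ofLp_add, WithLp.ofLp_smul, mulVec_add, mulVec_smul, hu, smul_zero, add_zero]
    exact hp.1
  have := hp.2 (hmem 1) (hmem (-1))
    ⟨1 / 2, 1 / 2, by norm_num, by norm_num, by norm_num, by module⟩
  have h0 : u = 0 := by simpa using this
  rw [h0, inner_zero_left]

/-- A bound for the norms of the extreme points of the pointed dual region, attained if it can be. -/
theorem exists_extremePoint_bound (A : Matrix (Fin M) (Fin N) ℝ) (c : Fin N → ℝ) :
    ∃ κ : ℝ, 0 ≤ κ ∧ (((dualFeasible A c).extremePoints ℝ).Nonempty →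
        IsGreatest ((fun p => ‖p‖) '' (dualFeasible A c).extremePoints ℝ) κ) ∧
      ∀ p ∈ (dualPointed A c).extremePoints ℝ, ‖p‖ ≤ κ := by
  rcases ((dualPointed A c).extremePoints ℝ).eq_empty_or_nonempty with h | h
  -- Without extreme points the bound is vacuous, and 0 is a default value.
  · refine ⟨0, le_rfl, fun h' => ?_, fun p hp => absurd hp (by simp [h])⟩
    rw [← dualPointed_eq_dualFeasible h', h] at h'
    exact absurd h' Set.not_nonempty_empty
  · obtain ⟨p, hp, hmax⟩ := Set.exists_max_image _ (fun p => ‖p‖)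
      (finite_extremePoints_dualPointed A c) h
    refine ⟨‖p‖, norm_nonneg p, fun h' => ?_, hmax⟩
    rw [← dualPointed_eq_dualFeasible h']
    exact ⟨⟨p, hp, rfl⟩, by rintro _ ⟨q, hq, rfl⟩; exact hmax q hq⟩

theorem abs_dotProduct_le_norm_mul_norm (r : Fin M → ℝ) (p : EuclideanSpace ℝ (Fin M)) :
    |r ⬝ᵥ p.ofLp| ≤ ‖p‖ * ‖WithLp.toLp 2 r‖ := by
  have h : r ⬝ᵥ p.ofLp = inner ℝ p (WithLp.toLp 2 r) := by
    simp [EuclideanSpace.inner_eq_star_dotProduct]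
  rw [h]
  exact abs_real_inner_le_norm _ _

end InexactRBCD

namespace InexactRBCD

variable {M N : ℕ} {A : Matrix (Fin M) (Fin N) ℝ} {b : Fin M → ℝ} {c : Fin N → ℝ}

/-! ### The subproblem as a linear program -/

/-- The vector `v` with the entries outside `I` replaced by zero. -/
def restrictVec (I : Finset (Fin N)) (v : Fin N → ℝ) : Fin N → ℝ := fun j => if j ∈ I then v j else 0

/-- The matrix `A` with the columns outside `I` replaced by zero. -/
def restrictCols (A : Matrix (Fin M) (Fin N) ℝ) (I : Finset (Fin N)) :
    Matrix (Fin M) (Fin N) ℝ := Matrix.of fun i => restrictVec I (A i)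

theorem restrictVec_dotProduct (I : Finset (Fin N)) (u v : Fin N → ℝ) :
    restrictVec I u ⬝ᵥ v = u ⬝ᵥ restrictVec I v :=
  Finset.sum_congr rfl fun j _ => by simp only [restrictVec]; split_ifs <;> simp

theorem restrictCols_mulVec (I : Finset (Fin N)) (v : Fin N → ℝ) :
    restrictCols A I *ᵥ v = A *ᵥ restrictVec I v :=
  funext fun i => restrictVec_dotProduct I (A i) v

theorem restrictCols_transpose_mulVec_le {I : Finset (Fin N)} {p : Fin M → ℝ}
    (hp : Aᵀ *ᵥ p ≤ c) : (restrictCols A I)ᵀ *ᵥ p ≤ restrictVec I c := fun j => by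
  have h : ((restrictCols A I)ᵀ *ᵥ p) j = restrictVec I (Aᵀ *ᵥ p) j := by
    simp only [restrictCols, mulVec, dotProduct, transpose_apply, of_apply, restrictVec]
    split_ifs <;> simp
  rw [h]
  simp only [restrictVec]
  split_ifs
  exacts [hp j, le_rfl]

theorem restrictVec_of_support {I : Finset (Fin N)} {d : Fin N → ℝ} (hd : ∀ i, i ∉ I → d i = 0) :
    restrictVec I d = d := funext fun j => by
  simp only [restrictVec]
  split_ifs with h
  exacts [rfl, (hd j h).symm]

theorem zero_mem_subFeasible {x : Fin N → ℝ} (hx : 0 ≤ x) (I : Finset (Fin N)) :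
    0 ∈ subFeasible A x I := ⟨by simpa using hx, mulVec_zero A, fun _ _ => rfl⟩

theorem subValue_eq {x d : Fin N → ℝ} {I : Finset (Fin N)} (hd : d ∈ subArgmin A c x I) :
    subValue A c x I = c ⬝ᵥ d :=
  IsLeast.csInf_eq ⟨⟨d, hd.1, rfl⟩, by rintro _ ⟨e, he, rfl⟩; exact hd.2 e he⟩

/-- Put y = x + d. With the columns and costs outside `I` set to zero, the subproblem becomes a
standard linear program whose dual polyhedron does not involve `x`; restricting y − x to `I`
recovers a direction. -/
theorem exists_mem_subArgmin_of_dual {x : Fin N → ℝ} {p : Fin M → ℝ} (hx : 0 ≤ x)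
    (hp : Aᵀ *ᵥ p ≤ c) (I : Finset (Fin N)) :
    ∃ d ∈ subArgmin A c x I,
      (∃ q ∈ (dualPointed (restrictCols A I) (restrictVec I c)).extremePoints ℝ,
        c ⬝ᵥ d = restrictCols A I *ᵥ x ⬝ᵥ q.ofLp - restrictVec I c ⬝ᵥ x) ∧
      ∀ q ∈ dualPointed (restrictCols A I) (restrictVec I c),
        restrictCols A I *ᵥ x ⬝ᵥ q.ofLp - restrictVec I c ⬝ᵥ x ≤ c ⬝ᵥ d := by
  obtain ⟨y, hy, q, hq, hyq⟩ := exists_optimal_pair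
    (b := restrictCols A I *ᵥ x) ⟨rfl, hx⟩ (restrictCols_transpose_mulVec_le (I := I) hp)
  have hcd : c ⬝ᵥ restrictVec I (y - x) = restrictVec I c ⬝ᵥ y - restrictVec I c ⬝ᵥ x := by
    rw [← restrictVec_dotProduct, dotProduct_sub]
  refine ⟨restrictVec I (y - x), ⟨⟨fun j => ?_, ?_, fun i hi => if_neg hi⟩, fun e he => ?_⟩,
    ⟨q, hq, by rw [hcd, hyq]⟩, fun q hq => ?_⟩
  · have h1 := hx j
    have h2 := hy.1.2 j
    simp only [Pi.zero_apply, Pi.add_apply, restrictVec, Pi.sub_apply] at h1 h2 ⊢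
    split_ifs <;> linarith
  · rw [← restrictCols_mulVec, mulVec_sub, hy.1.1, sub_self]
  · have h1 := hy.2 (x + e) ⟨by
      rw [mulVec_add, restrictCols_mulVec I e, restrictVec_of_support he.2.2, he.2.1, add_zero],
      he.1⟩
    rw [dotProduct_add, restrictVec_dotProduct I c e, restrictVec_of_support he.2.2] at h1
    rw [hcd]
    linarith
  · rw [hcd]
    linarith [weak_duality hy.1 hq.1]

theorem exists_mem_subArgmin {x : Fin N → ℝ} {p : Fin M → ℝ} (hx : 0 ≤ x)
    (hp : Aᵀ *ᵥ p ≤ c) (I : Finset (Fin N)) : ∃ d, d ∈ subArgmin A c x I :=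
  let ⟨d, hd, _⟩ := exists_mem_subArgmin_of_dual hx hp I
  ⟨d, hd⟩

theorem subValue_le {x e : Fin N → ℝ} {p : Fin M → ℝ} (hx : 0 ≤ x) (hp : Aᵀ *ᵥ p ≤ c)
    {I : Finset (Fin N)} (he : e ∈ subFeasible A x I) : subValue A c x I ≤ c ⬝ᵥ e := by
  obtain ⟨d, hd⟩ := exists_mem_subArgmin hx hp I
  exact (subValue_eq hd).trans_le (hd.2 e he)

theorem subValue_nonpos {x : Fin N → ℝ} {p : Fin M → ℝ} (hx : 0 ≤ x) (hp : Aᵀ *ᵥ p ≤ c)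
    (I : Finset (Fin N)) : subValue A c x I ≤ 0 :=
  (subValue_le hx hp (zero_mem_subFeasible hx I)).trans_eq (dotProduct_zero c)

/-- On the nonnegative orthant the optimal value of the subproblem is a maximum of finitely many
linear functions. -/
theorem exists_measurable_subValue {p : Fin M → ℝ} (hp : Aᵀ *ᵥ p ≤ c) (I : Finset (Fin N)) :
    ∃ g : (Fin N → ℝ) → ℝ, Measurable g ∧ ∀ x, 0 ≤ x → subValue A c x I = g x := by
  set E := (finite_extremePoints_dualPointed (restrictCols A I) (restrictVec I c)).toFinset
    with hE
  have hne : E.Nonempty := by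
    obtain ⟨-, -, ⟨q, hq, -⟩, -⟩ := exists_mem_subArgmin_of_dual le_rfl hp I
    exact ⟨q, by simpa [hE] using hq⟩
  let φ : EuclideanSpace ℝ (Fin M) → (Fin N → ℝ) → ℝ := fun q x =>
    restrictCols A I *ᵥ x ⬝ᵥ q.ofLp - restrictVec I c ⬝ᵥ x
  have hφ : ∀ q, Measurable (φ q) := fun q => by
    refine Continuous.measurable ?_
    fun_prop
  refine ⟨E.sup' hne φ, Finset.measurable_sup' hne fun q _ => hφ q, fun x hx => ?_⟩
  obtain ⟨d, hd, ⟨q, hq, hdq⟩, hle⟩ := exists_mem_subArgmin_of_dual hx hp I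
  rw [subValue_eq hd, Finset.sup'_apply]
  refine le_antisymm ?_ (Finset.sup'_le _ _ fun q hq => ?_)
  · rw [hdq]
    exact Finset.le_sup' (fun q => φ q x) (by simpa [hE] using hq)
  · rw [hE, Set.Finite.mem_toFinset] at hq
    exact hle q hq.1

/-! ### Conformal decomposition -/

/-- The support of a vector. -/
noncomputable def supp (d : Fin N → ℝ) : Finset (Fin N) := Finset.univ.filter fun j => d j ≠ 0

theorem mem_supp {d : Fin N → ℝ} {j : Fin N} : j ∈ supp d ↔ d j ≠ 0 := by simp [supp]

/-- `f` has the sign pattern of `d`. -/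
def SignConformal (f d : Fin N → ℝ) : Prop := ∀ j, ∃ r, 0 ≤ r ∧ f j = r * d j

theorem SignConformal.trans {e f d : Fin N → ℝ} (h : SignConformal e f) (h' : SignConformal f d) :
    SignConformal e d := fun j => by
  obtain ⟨r, hr, h⟩ := h j
  obtain ⟨s, hs, h'⟩ := h' j
  exact ⟨r * s, mul_nonneg hr hs, by rw [h, h', mul_assoc]⟩

/-- Ratio test on the coordinates with z j * d j > 0, where subtracting t z moves `d j` towards
zero: the step stops when the first of them vanishes, before any sign changes. -/
theorem exists_conformal_step {d z : Fin N → ℝ} (hz : ∀ j, d j = 0 → z j = 0)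
    (hpos : ∃ j, 0 < z j * d j) :
    ∃ t : ℝ, 0 < t ∧ SignConformal (d - t • z) d ∧ supp (d - t • z) ⊂ supp d := by
  obtain ⟨t, ht, hle, i, hi, hi'⟩ := exists_max_step (g := fun j => d j * d j)
    (h := fun j => z j * d j) (fun j => mul_self_nonneg _)
    (fun j hj => by simp only [mul_self_eq_zero] at hj; rw [hj, mul_zero]) hpos
  have hdi : d i ≠ 0 := by simpa using hi
  refine ⟨t, ht, fun j => ?_, fun j hj => ?_, fun hsub => ?_⟩
  · by_cases hj : d j = 0
    · exact ⟨0, le_rfl, by simp [hj, hz j hj]⟩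
    · refine ⟨(d j * d j - t * (z j * d j)) / (d j * d j),
        div_nonneg (sub_nonneg.2 (hle j)) (mul_self_nonneg _), ?_⟩
      simp only [Pi.sub_apply, Pi.smul_apply, smul_eq_mul]
      field_simp
  · rw [mem_supp] at hj ⊢
    exact fun h0 => hj (by simp [h0, hz j h0])
  · refine mem_supp.1 (hsub (mem_supp.2 hdi)) ?_
    have : (d i - t * z i) * d i = 0 := by linarith
    simpa [hdi] using this

theorem exists_kernel_vector_of_rank_lt (T : Finset (Fin N)) (hT : A.rank < T.card) :
    ∃ z : Fin N → ℝ, z ≠ 0 ∧ A *ᵥ z = 0 ∧ ∀ j, j ∉ T → z j = 0 := by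
  classical
  let E : (T → ℝ) →ₗ[ℝ] (Fin N → ℝ) := Function.ExtendByZero.linearMap ℝ (Subtype.val : T → Fin N)
  have hker : LinearMap.ker (A.mulVecLin.rangeRestrict ∘ₗ E) ≠ ⊥ :=
    LinearMap.ker_ne_bot_of_finrank_lt (by
      rw [Module.finrank_pi, Fintype.card_coe]
      exact hT)
  obtain ⟨w, hw, hw0⟩ := (Submodule.ne_bot_iff _).1 hker
  have hE : E w = Function.extend Subtype.val w 0 := rfl
  have hEj : ∀ j : T, E w j = w j := fun j => by
    rw [hE, Subtype.val_injective.extend_apply]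
  refine ⟨E w, fun h0 => hw0 (funext fun j => by rw [← hEj, h0]; rfl), ?_, fun j hj => ?_⟩
  · simpa using congrArg Subtype.val (LinearMap.mem_ker.1 hw)
  · rw [hE, Function.extend_apply' _ _ _ (by rintro ⟨k, rfl⟩; exact hj k.2), Pi.zero_apply]

theorem exists_pos_mul_of_ne_zero {d z : Fin N → ℝ} (hz0 : z ≠ 0)
    (hz : ∀ j, d j = 0 → z j = 0) :
    (∃ j, 0 < z j * d j) ∨ ∃ j, 0 < (-z) j * d j := by
  obtain ⟨j, hj⟩ := Function.ne_iff.1 hz0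
  have hd : d j ≠ 0 := fun h0 => hj (hz j h0)
  rcases lt_or_gt_of_ne (mul_ne_zero hj hd) with h | h
  · exact .inr ⟨j, by simpa using h⟩
  · exact .inl ⟨j, h⟩

/-- Every nonzero kernel vector has a conformal kernel vector of small support. -/
theorem exists_conformal_kernel_vector (d : Fin N → ℝ) (hd : A *ᵥ d = 0) (hd0 : d ≠ 0) :
    ∃ f : Fin N → ℝ, f ≠ 0 ∧ A *ᵥ f = 0 ∧ SignConformal f d ∧ (supp f).card ≤ A.rank + 1 := by
  induction hn : (supp d).card using Nat.strong_induction_on generalizing d with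
  | _ n ih =>
    by_cases hcard : (supp d).card ≤ A.rank + 1
    · exact ⟨d, hd0, hd, fun j => ⟨1, zero_le_one, (one_mul _).symm⟩, hcard⟩
    obtain ⟨T, hTd, hT⟩ := Finset.exists_subset_card_eq (not_le.1 hcard).le
    have hz : ∃ z : Fin N → ℝ, A *ᵥ z = 0 ∧ (∀ j, j ∉ T → z j = 0) ∧ ∃ j, 0 < z j * d j := by
      obtain ⟨z, hz0, hAz, hzT⟩ := exists_kernel_vector_of_rank_lt (A := A) T (by omega)
      rcases exists_pos_mul_of_ne_zero (d := d) hz0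
        (fun j hj => hzT j fun hjT => mem_supp.1 (hTd hjT) hj) with h | h
      · exact ⟨z, hAz, hzT, h⟩
      · exact ⟨-z, by rw [mulVec_neg, hAz, neg_zero], fun j hj => by simp [hzT j hj], h⟩
    obtain ⟨z, hAz, hzT, hpos⟩ := hz
    obtain ⟨t, ht, hconf, hss⟩ := exists_conformal_step
      (fun j hj => hzT j fun hjT => mem_supp.1 (hTd hjT) hj) hpos
    -- Otherwise d = t z would be supported on `T`, which has only rank + 1 elements.
    have hne : d - t • z ≠ 0 := fun h0 => hcard (by
      rw [← hT]
      refine Finset.card_le_card fun j hj => ?_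
      by_contra hjT
      refine mem_supp.1 hj ?_
      have := congrFun h0 j
      simpa [hzT j hjT] using this)
    obtain ⟨f, hf0, hAf, hf, hfc⟩ := ih _ (hn ▸ Finset.card_lt_card hss) (d - t • z)
      (by rw [mulVec_sub, mulVec_smul, hd, hAz, smul_zero, sub_zero]) hne rfl
    exact ⟨f, hf0, hAf, hf.trans hconf, hfc⟩

/-- `e` is between `0` and `d` in each coordinate. -/
def Between (e d : Fin N → ℝ) : Prop := ∀ j, ∃ r, 0 ≤ r ∧ r ≤ 1 ∧ e j = r * d j

theorem Between.trans {e f d : Fin N → ℝ} (h : Between e f) (h' : Between f d) : Between e d :=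
  fun j => by
    obtain ⟨r, hr, hr1, h⟩ := h j
    obtain ⟨s, hs, hs1, h'⟩ := h' j
    exact ⟨r * s, mul_nonneg hr hs, mul_le_one₀ hr1 hs hs1, by rw [h, h', mul_assoc]⟩

/-- The small kernel vector is rescaled so that subtracting it removes a coordinate from the support
without reversing a sign. Both parts then agree in sign with `d` and sum to it, so each lies between
0 and `d`. -/
theorem exists_conformal_split {d : Fin N → ℝ} (hd : A *ᵥ d = 0) (hd0 : d ≠ 0) :
    ∃ f : Fin N → ℝ, A *ᵥ f = 0 ∧ (supp f).card ≤ A.rank + 1 ∧ Between f d ∧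
      Between (d - f) d ∧ supp (d - f) ⊂ supp d := by
  obtain ⟨f, hf0, hAf, hf, hfc⟩ := exists_conformal_kernel_vector d hd hd0
  have hfd : ∀ j, d j = 0 → f j = 0 := fun j hj => by
    obtain ⟨r, -, h⟩ := hf j
    rw [h, hj, mul_zero]
  have hpos : ∃ j, 0 < f j * d j := by
    obtain ⟨j, hj⟩ := Function.ne_iff.1 hf0
    obtain ⟨r, hr, h⟩ := hf j
    have hr0 : r ≠ 0 := by rintro rfl; exact hj (by simpa using h)
    have hd0 : d j ≠ 0 := fun h0 => hj (hfd j h0)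
    refine ⟨j, ?_⟩
    rw [h, mul_assoc]
    exact mul_pos (hr.lt_of_ne' hr0) (mul_self_pos.2 hd0)
  obtain ⟨t, ht, hconf, hss⟩ := exists_conformal_step hfd hpos
  have key : ∀ j, ∃ r, 0 ≤ r ∧ r ≤ 1 ∧ t * f j = r * d j := fun j => by
    by_cases hj : d j = 0
    · exact ⟨0, le_rfl, zero_le_one, by rw [hfd j hj, mul_zero, zero_mul]⟩
    obtain ⟨r, hr, h⟩ := hf j
    obtain ⟨s, hs, h'⟩ := hconf j
    simp only [Pi.sub_apply, Pi.smul_apply, smul_eq_mul] at h'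
    refine ⟨t * r, mul_nonneg ht.le hr, ?_, by rw [h, mul_assoc]⟩
    have h3 : (1 - t * r - s) * d j = 0 := by rw [h] at h'; linear_combination h'
    have := (mul_eq_zero.1 h3).resolve_right hj
    linarith
  have hsupp : supp (t • f) = supp f := by
    ext j
    simp [mem_supp, ht.ne']
  refine ⟨t • f, by rw [mulVec_smul, hAf, smul_zero], hsupp ▸ hfc, key, fun j => ?_, hss⟩
  obtain ⟨r, hr, hr1, h⟩ := key j
  refine ⟨1 - r, by linarith, by linarith, ?_⟩
  simp only [Pi.sub_apply, Pi.smul_apply, smul_eq_mul, h]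
  ring

/-- Among the terms of a conformal decomposition of a kernel vector into terms of support at most
`l`, one contributes at least an average share of the objective. -/
theorem exists_between_small_support {l : ℕ} (hl : A.rank + 1 ≤ l) (n : ℕ) (d : Fin N → ℝ)
    (hd : A *ᵥ d = 0) (hn : (supp d).card ≤ l + n) :
    ∃ e : Fin N → ℝ, A *ᵥ e = 0 ∧ (supp e).card ≤ l ∧ Between e d ∧
      ((n : ℝ) + 1) * (c ⬝ᵥ e) ≤ c ⬝ᵥ d := by
  induction n generalizing d with
  | zero => exact ⟨d, hd, hn, fun j => ⟨1, zero_le_one, le_rfl, (one_mul _).symm⟩, by simp⟩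
  | succ n ih =>
    by_cases hd0 : d = 0
    · subst hd0
      exact ⟨0, hd, by simp [supp], fun j => ⟨0, le_rfl, zero_le_one, by simp⟩, by simp⟩
    obtain ⟨f, hAf, hfc, hfd, hdf, hss⟩ := exists_conformal_split hd hd0
    obtain ⟨e, hAe, hec, hed, hce⟩ := ih (d - f) (by rw [mulVec_sub, hd, hAf, sub_zero])
      (by have := Finset.card_lt_card hss; omega)
    rw [dotProduct_sub] at hce
    push_cast
    -- Since (n + 1)(c·e) + c·f ≤ c·d, the smaller of c·e and c·f has the required share.
    rcases le_total (c ⬝ᵥ e) (c ⬝ᵥ f) with h | h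
    · exact ⟨e, hAe, hec, hed.trans hdf, by linarith⟩
    · refine ⟨f, hAf, hfc.trans hl, hfd, ?_⟩
      have := mul_le_mul_of_nonneg_left h (by positivity : (0 : ℝ) ≤ (n : ℝ) + 1)
      linarith

/-- A support has at most N = l + (N − l) elements, whence the factor N − l + 1. The chosen term `e`
is feasible because x + e lies between x and x + d. -/
theorem exists_card_eq_mul_subValue_le {x : Fin N → ℝ} {p : Fin M → ℝ} (hx : 0 ≤ x)
    (hp : Aᵀ *ᵥ p ≤ c) {l : ℕ} (hl : A.rank + 1 ≤ l) (hlN : l ≤ N) :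
    ∃ S : Finset (Fin N), S.card = l ∧
      ((N : ℝ) - l + 1) * subValue A c x S ≤ subValue A c x Finset.univ := by
  obtain ⟨d, hd⟩ := exists_mem_subArgmin hx hp Finset.univ
  obtain ⟨e, hAe, hec, hed, hce⟩ := exists_between_small_support (c := c) hl (N - l) d hd.1.2.1
    ((Finset.card_le_univ _).trans (by simp; omega))
  obtain ⟨S, hS, hSl⟩ := Finset.exists_superset_card_eq hec (by simpa using hlN)
  rw [Nat.cast_sub hlN] at hce
  refine ⟨S, hSl, ?_⟩
  rw [subValue_eq hd]
  refine le_trans (mul_le_mul_of_nonneg_left (subValue_le hx hp ⟨fun j => ?_, hAe, fun j hj => ?_⟩)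
    ?_) hce
  · obtain ⟨r, hr, hr1, h⟩ := hed j
    have h1 := hx j
    have h2 := hd.1.1 j
    simp only [Pi.zero_apply, Pi.add_apply] at h1 h2 ⊢
    rw [h]
    nlinarith
  · by_contra h0
    exact hj (hS (mem_supp.2 h0))
  · have : (l : ℝ) ≤ N := by exact_mod_cast hlN
    linarith

end InexactRBCD

/-! ### Averaging over an independent random index -/

namespace InexactRBCD

/-- Conditional expectation of a family of `m`-measurable variables, indexed by a random index that
is independent of `m`. -/
theorem condExp_comp_of_indep {Ω ι : Type*} [Fintype ι] {m mΩ : MeasurableSpace Ω} {P : Measure Ω}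
    [IsProbabilityMeasure P] (hm : m ≤ mΩ) {I : Ω → ι} (hI : ∀ S, MeasurableSet {ω | I ω = S})
    (hind : Indep (MeasurableSpace.comap I ⊤) m P) {f : ι → Ω → ℝ}
    (hf : ∀ S, StronglyMeasurable[m] (f S)) (hint : ∀ S, Integrable (f S) P) :
    Integrable (fun ω => f (I ω) ω) P ∧
      P[fun ω => f (I ω) ω | m] =ᵐ[P] fun ω => ∑ S, P.real {ω | I ω = S} * f S ω := by
  classical
  have hle : MeasurableSpace.comap I ⊤ ≤ mΩ := by
    let : MeasurableSpace ι := ⊤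
    exact (measurable_to_countable' hI).comap_le
  let ind : ι → Ω → ℝ := fun S => {ω | I ω = S}.indicator fun _ => 1
  have hsum : (fun ω => f (I ω) ω) = ∑ S, ind S * f S := by
    ext ω
    simp [ind, Set.indicator_apply, Finset.sum_apply]
  have hind_meas : ∀ S, StronglyMeasurable[MeasurableSpace.comap I ⊤] (ind S) := fun S =>
    (@stronglyMeasurable_const _ _ (MeasurableSpace.comap I ⊤) _ _).indicator
      ⟨{S}, trivial, rfl⟩
  have hprod : ∀ S, ind S * f S = {ω | I ω = S}.indicator (f S) := fun S => by
    ext ω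
    simp [ind, Set.indicator_apply]
  have hprod_int : ∀ S, Integrable (ind S * f S) P := fun S => by
    rw [hprod]
    exact (hint S).indicator (hI S)
  have hind_int : ∀ S, Integrable (ind S) P := fun S => (integrable_const 1).indicator (hI S)
  rw [hsum]
  refine ⟨integrable_finsetSum' _ fun S _ => hprod_int S, ?_⟩
  -- The factor `f S` is pulled out, and independence makes the conditional expectation of the
  -- indicator constant.
  have hterm : ∀ S, P[ind S * f S | m] =ᵐ[P] fun ω => P.real {ω | I ω = S} * f S ω := fun S => by
    have h1 := condExp_mul_of_aestronglyMeasurable_right (hf S).aestronglyMeasurable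
      (hprod_int S) (hind_int S)
    have h2 := condExp_indep_eq hle hm (hind_meas S) hind
    filter_upwards [h1, h2] with ω h1 h2
    rw [h1, Pi.mul_apply, h2]
    congr 1
    simp only [ind]
    rw [integral_indicator_const _ (hI S), smul_eq_mul, mul_one]
  refine (condExp_finsetSum (fun S _ => hprod_int S) m).trans ?_
  filter_upwards [ae_all_iff.2 hterm] with ω hω
  rw [Finset.sum_apply]
  exact Finset.sum_congr rfl fun S _ => hω S

variable {M N : ℕ} {A : Matrix (Fin M) (Fin N) ℝ} {b : Fin M → ℝ} {c : Fin N → ℝ}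

theorem exists_extremePoint_dual_optimal {xstar : Fin N → ℝ} (hopt : xstar ∈ lpOptimal A b c) :
    ∃ q ∈ (dualPointed A c).extremePoints ℝ, b ⬝ᵥ q.ofLp = c ⬝ᵥ xstar := by
  obtain ⟨p, hp, -⟩ := exists_dual_certificate hopt
  obtain ⟨y, hy, q, hq, h⟩ := exists_optimal_pair hopt.1 hp
  exact ⟨q, hq, by rw [← h]; exact le_antisymm (hy.2 _ hopt.1) (hopt.2 _ hy.1)⟩

/-! ### Perturbation of the right-hand side -/

section Perturbation

variable {κ δ : ℝ} {xstar x : Fin N → ℝ}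

theorem abs_perturbation_le (hκ : ∀ p ∈ (dualPointed A c).extremePoints ℝ, ‖p‖ ≤ κ)
    (hδ : ‖WithLp.toLp 2 (A *ᵥ x - b)‖ ≤ δ) {q : EuclideanSpace ℝ (Fin M)}
    (hq : q ∈ (dualPointed A c).extremePoints ℝ) :
    |A *ᵥ x ⬝ᵥ q.ofLp - b ⬝ᵥ q.ofLp| ≤ κ * δ := by
  rw [← sub_dotProduct]
  exact (abs_dotProduct_le_norm_mul_norm _ _).trans
    (mul_le_mul (hκ q hq) hδ (norm_nonneg _) ((norm_nonneg q).trans (hκ q hq)))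

/-- An extreme dual optimum for `b` remains dual feasible at right-hand side `A x`, so weak duality
applies to it there. -/
theorem sub_le_objective (hκ : ∀ p ∈ (dualPointed A c).extremePoints ℝ, ‖p‖ ≤ κ)
    (hopt : xstar ∈ lpOptimal A b c) (hx : 0 ≤ x) (hδ : ‖WithLp.toLp 2 (A *ᵥ x - b)‖ ≤ δ) :
    c ⬝ᵥ xstar - κ * δ ≤ c ⬝ᵥ x := by
  obtain ⟨q, hq, hqb⟩ := exists_extremePoint_dual_optimal hopt
  have h1 := (abs_le.1 (abs_perturbation_le hκ hδ hq)).1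
  have h2 := weak_duality (b := A *ᵥ x) ⟨rfl, hx⟩ hq.1.1
  linarith

/-- Here the extreme dual optimum `q` is taken at `A x`. The value (A x)·q exceeds b·q ≤ c·x* by at
most κδ, and y − x is a feasible direction towards the primal optimum `y` there. -/
theorem subValue_univ_le_gap (hκ : ∀ p ∈ (dualPointed A c).extremePoints ℝ, ‖p‖ ≤ κ)
    (hopt : xstar ∈ lpOptimal A b c) (hx : 0 ≤ x) (hδ : ‖WithLp.toLp 2 (A *ᵥ x - b)‖ ≤ δ) :
    subValue A c x Finset.univ ≤ c ⬝ᵥ xstar + κ * δ - c ⬝ᵥ x := by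
  obtain ⟨p, hp, -⟩ := exists_dual_certificate hopt
  obtain ⟨y, hy, q, hq, hyq⟩ := exists_optimal_pair (b := A *ᵥ x) ⟨rfl, hx⟩ hp
  have h1 := (abs_le.1 (abs_perturbation_le hκ hδ hq)).2
  have h2 := weak_duality hopt.1 hq.1.1
  have h3 := subValue_le (I := Finset.univ) (e := y - x) hx hp
    ⟨by rw [add_sub_cancel]; exact hy.1.2, by rw [mulVec_sub, hy.1.1, sub_self],
      fun i hi => absurd (Finset.mem_univ i) hi⟩
  rw [dotProduct_sub] at h3
  linarith

/-- An exact step preserves the residual, so the lower bound holds at x + d. It serves to make the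
subproblem values integrable. -/
theorem gap_le_subValue (hκ : ∀ p ∈ (dualPointed A c).extremePoints ℝ, ‖p‖ ≤ κ)
    (hopt : xstar ∈ lpOptimal A b c) (hx : 0 ≤ x) (hδ : ‖WithLp.toLp 2 (A *ᵥ x - b)‖ ≤ δ)
    (S : Finset (Fin N)) : c ⬝ᵥ xstar - κ * δ - c ⬝ᵥ x ≤ subValue A c x S := by
  obtain ⟨p, hp, -⟩ := exists_dual_certificate hopt
  obtain ⟨d, hd⟩ := exists_mem_subArgmin hx hp S
  have := sub_le_objective (x := x + d) (δ := δ) hκ hopt hd.1.1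
    (by rwa [mulVec_add, hd.1.2.1, add_zero])
  rw [dotProduct_add] at this
  rw [subValue_eq hd]
  linarith

end Perturbation

/-! ### Integrability and expected decrease along a run -/

section Run

theorem measurable_history {Ω : Type*} (x : ℕ → Ω → Fin N → ℝ) (k : ℕ) : Measurable[history x k] (x k) :=
  (comap_measurable (x k)).mono
    (le_iSup₂ (f := fun j (_ : j ≤ k) => MeasurableSpace.comap (x j) inferInstance) k le_rfl) le_rfl

variable {κ δ ε : ℝ} {xstar : Fin N → ℝ} {l : ℕ} {εseq εhat : ℕ → ℝ} {Ω : Type*}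
  [MeasurableSpace Ω] {P : Measure Ω} {x d : ℕ → Ω → Fin N → ℝ} {I : ℕ → Ω → Finset (Fin N)}

theorem history_le (hx : ∀ k, Measurable (x k)) (k : ℕ) : history x k ≤ ‹MeasurableSpace Ω› :=
  iSup₂_le fun j _ => (hx j).comap_le

theorem IsRun.ae_near_feasible (h : IsRun A b c l εseq εhat P x d I) (hhat : ∀ k, 0 ≤ εhat k)
    (hsum : Summable εhat) (hδ : ∑' k, εhat k ≤ δ) :
    ∀ᵐ ω ∂P, ∀ k, ‖WithLp.toLp 2 (A *ᵥ x k ω - b)‖ ≤ δ ∧ 0 ≤ x k ω := by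
  filter_upwards [h.init_feasible, ae_all_iff.2 h.inexact] with ω h0 hstep
  have key : ∀ k, ‖WithLp.toLp 2 (A *ᵥ x k ω - b)‖ ≤ ∑ j ∈ Finset.range k, εhat j := fun k => by
    induction k with
    | zero => simp [h0.1]
    | succ k ih =>
      have : WithLp.toLp 2 (A *ᵥ x (k + 1) ω - b)
          = WithLp.toLp 2 (A *ᵥ x k ω - b) + WithLp.toLp 2 (A *ᵥ d k ω) := by
        rw [← WithLp.toLp_add, h.update, mulVec_add, sub_add_eq_add_sub]
      rw [this, Finset.sum_range_succ]
      exact (norm_add_le _ _).trans (add_le_add ih (hstep k).2.2.1)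
  refine fun k => ⟨(key k).trans ((hsum.sum_le_tsum _ fun j _ => hhat j).trans hδ), ?_⟩
  cases k with
  | zero => exact h0.2
  | succ k =>
    rw [h.update]
    exact (hstep k).2.1

theorem IsRun.ae_objective_step (h : IsRun A b c l εseq εhat P x d I)
    (hnear : ∀ᵐ ω ∂P, ∀ k, ‖WithLp.toLp 2 (A *ᵥ x k ω - b)‖ ≤ δ ∧ 0 ≤ x k ω)
    {p : Fin M → ℝ} (hp : Aᵀ *ᵥ p ≤ c) :
    ∀ᵐ ω ∂P, ∀ k,
      c ⬝ᵥ x (k + 1) ω ≤ c ⬝ᵥ x k ω + (1 - εseq k) * subValue A c (x k ω) (I k ω) := by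
  filter_upwards [hnear, ae_all_iff.2 h.inexact] with ω hω hstep k
  obtain ⟨e, he⟩ := exists_mem_subArgmin (hω k).2 hp (I k ω)
  rw [h.update, dotProduct_add, subValue_eq he]
  linarith [(hstep k).1 e he]

theorem measurable_objective (h : ∀ k, Measurable (x k)) (k : ℕ) :
    Measurable fun ω => c ⬝ᵥ x k ω :=
  (show Continuous fun y : Fin N → ℝ => c ⬝ᵥ y by fun_prop).measurable.comp (h k)

/-- The objective almost surely does not increase and is bounded below, so integrability passes from
each iterate to the next. -/
theorem IsRun.integrable_objective [IsProbabilityMeasure P]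
    (h : IsRun A b c l εseq εhat P x d I)
    (hκ : ∀ p ∈ (dualPointed A c).extremePoints ℝ, ‖p‖ ≤ κ) (hopt : xstar ∈ lpOptimal A b c)
    (hε : ∀ k, εseq k ≤ 1)
    (hnear : ∀ᵐ ω ∂P, ∀ k, ‖WithLp.toLp 2 (A *ᵥ x k ω - b)‖ ≤ δ ∧ 0 ≤ x k ω) (k : ℕ) :
    Integrable (fun ω => c ⬝ᵥ x k ω) P := by
  induction k with
  | zero => exact h.init_integrable
  | succ k ih =>
    obtain ⟨p, hp, -⟩ := exists_dual_certificate hopt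
    refine integrable_of_le_of_le (measurable_objective h.measurable_x _).aestronglyMeasurable
      ?_ ?_ (integrable_const (c ⬝ᵥ xstar - κ * δ)) ih
    · filter_upwards [hnear] with ω hω
      exact sub_le_objective hκ hopt (hω (k + 1)).2 (hω (k + 1)).1
    · filter_upwards [hnear, h.ae_objective_step hnear hp] with ω hω hstep
      have := mul_nonpos_of_nonneg_of_nonpos (sub_nonneg.2 (hε k))
        (subValue_nonpos (hω k).2 hp (I k ω))
      linarith [hstep k]

theorem IsRun.condExp_subValue [IsProbabilityMeasure P]
    (h : IsRun A b c l εseq εhat P x d I)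
    (hκ : ∀ p ∈ (dualPointed A c).extremePoints ℝ, ‖p‖ ≤ κ) (hopt : xstar ∈ lpOptimal A b c)
    (hε : ∀ k, εseq k ≤ 1)
    (hnear : ∀ᵐ ω ∂P, ∀ k, ‖WithLp.toLp 2 (A *ᵥ x k ω - b)‖ ≤ δ ∧ 0 ≤ x k ω) (k : ℕ) :
    (∀ S, Integrable (fun ω => subValue A c (x k ω) S) P) ∧
      Integrable (fun ω => subValue A c (x k ω) (I k ω)) P ∧
      P[fun ω => subValue A c (x k ω) (I k ω) | history x k] =ᵐ[P]
        fun ω => ∑ S, P.real {ω | I k ω = S} * subValue A c (x k ω) S := by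
  obtain ⟨p, hp, -⟩ := exists_dual_certificate hopt
  -- These measurable substitutes agree with `subValue` on the nonnegative orthant, which contains
  -- the iterates almost surely.
  choose g hg hgx using fun S => exists_measurable_subValue hp S
  have hae : ∀ᵐ ω ∂P, ∀ S, subValue A c (x k ω) S = g S (x k ω) := by
    filter_upwards [hnear] with ω hω S
    exact hgx S _ (hω k).2
  have hmeas : ∀ S, Measurable[history x k] fun ω => g S (x k ω) := fun S =>
    (hg S).comp (measurable_history x k)
  have hobj := h.integrable_objective hκ hopt hε hnear k
  have hint : ∀ S, Integrable (fun ω => g S (x k ω)) P := fun S => by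
    refine integrable_of_le_of_le
      ((hmeas S).mono (history_le h.measurable_x k) le_rfl).aestronglyMeasurable ?_ ?_
      ((integrable_const (c ⬝ᵥ xstar - κ * δ)).sub hobj) (integrable_const 0)
    · filter_upwards [hnear, hae] with ω hω hgω
      rw [← hgω S]
      exact gap_le_subValue hκ hopt (hω k).2 (hω k).1 S
    · filter_upwards [hnear, hae] with ω hω hgω
      rw [← hgω S]
      exact subValue_nonpos (hω k).2 hp S
  obtain ⟨h1, h2⟩ := condExp_comp_of_indep (history_le h.measurable_x k) (h.measurable_I k)
    (h.indep k) (fun S => (hmeas S).stronglyMeasurable) hint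
  have hI : (fun ω => subValue A c (x k ω) (I k ω)) =ᵐ[P] fun ω => g (I k ω) (x k ω) := by
    filter_upwards [hae] with ω hω
    exact hω _
  refine ⟨fun S => (hint S).congr (by filter_upwards [hae] with ω hω using (hω S).symm),
    h1.congr hI.symm, (condExp_congr_ae hI).trans (h2.trans ?_)⟩
  filter_upwards [hae] with ω hω
  exact Finset.sum_congr rfl fun S _ => by rw [hω S]

theorem IsRun.expectedGSq [IsProbabilityMeasure P]
    (h : IsRun A b c l εseq εhat P x d I)
    (hκ : ∀ p ∈ (dualPointed A c).extremePoints ℝ, ‖p‖ ≤ κ) (hopt : xstar ∈ lpOptimal A b c)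
    (hε : ∀ k, εseq k ≤ 1)
    (hnear : ∀ᵐ ω ∂P, ∀ k, ‖WithLp.toLp 2 (A *ᵥ x k ω - b)‖ ≤ δ ∧ 0 ≤ x k ω) :
    ExpectedGSq A c P x I (1 / ((N.choose l : ℝ) * ((N : ℝ) - l + 1))) := by
  obtain ⟨p, hp, -⟩ := exists_dual_certificate hopt
  have hlN : (l : ℝ) ≤ N := by exact_mod_cast h.le_dim
  have hch : (1 : ℝ) ≤ N.choose l := by exact_mod_cast Nat.choose_pos h.le_dim
  have hs : (1 : ℝ) ≤ (N : ℝ) - l + 1 := by linarith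
  have hone : 1 ≤ (N.choose l : ℝ) * ((N : ℝ) - l + 1) := one_le_mul_of_one_le_of_one_le hch hs
  refine ⟨by positivity, (div_le_one (by positivity)).2 hone, fun k => ?_⟩
  filter_upwards [(h.condExp_subValue hκ hopt hε hnear k).2.2, hnear] with ω hω hnω
  obtain ⟨S, hS, hle⟩ := exists_card_eq_mul_subValue_le (hnω k).2 hp h.rank_lt h.le_dim
  have hPS : P.real {ω | I k ω = S} = (N.choose l : ℝ)⁻¹ := by
    rw [Measure.real, h.uniform k S hS, ENNReal.toReal_inv, ENNReal.toReal_natCast]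
  rw [hω, ← Finset.add_sum_erase _ _ (Finset.mem_univ S), hPS]
  -- Only the one good batch is retained; the others can only lower the expectation.
  have hrest : ∑ T ∈ Finset.univ.erase S, P.real {ω | I k ω = T} * subValue A c (x k ω) T ≤ 0 :=
    Finset.sum_nonpos fun T _ =>
      mul_nonpos_of_nonneg_of_nonpos measureReal_nonneg (subValue_nonpos (hnω k).2 hp T)
  have hmain : subValue A c (x k ω) S
      ≤ ((N : ℝ) - l + 1)⁻¹ * subValue A c (x k ω) Finset.univ := by
    rw [le_inv_mul_iff₀ (by linarith)]
    exact hle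
  have := mul_le_mul_of_nonneg_left hmain (by positivity : 0 ≤ (N.choose l : ℝ)⁻¹)
  rw [one_div, mul_inv, mul_assoc]
  linarith

theorem IsRun.integral_gap_succ_le [IsProbabilityMeasure P]
    (h : IsRun A b c l εseq εhat P x d I)
    (hκ : ∀ p ∈ (dualPointed A c).extremePoints ℝ, ‖p‖ ≤ κ) (hopt : xstar ∈ lpOptimal A b c)
    (hε : ε ≤ 1) (hεseq : ∀ k, εseq k ≤ ε)
    (hnear : ∀ᵐ ω ∂P, ∀ k, ‖WithLp.toLp 2 (A *ᵥ x k ω - b)‖ ≤ δ ∧ 0 ≤ x k ω)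
    {v : ℝ} (hv : ExpectedGSq A c P x I v) (k : ℕ) :
    ∫ ω, (c ⬝ᵥ x (k + 1) ω - (c ⬝ᵥ xstar + κ * δ)) ∂P ≤
      (1 - (1 - ε) * v) * ∫ ω, (c ⬝ᵥ x k ω - (c ⬝ᵥ xstar + κ * δ)) ∂P := by
  obtain ⟨p, hp, -⟩ := exists_dual_certificate hopt
  have hε1 : ∀ k, εseq k ≤ 1 := fun k => (hεseq k).trans hε
  have hobj := fun k => h.integrable_objective hκ hopt hε1 hnear k
  obtain ⟨hS, hI, -⟩ := h.condExp_subValue hκ hopt hε1 hnear k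
  set F := c ⬝ᵥ xstar + κ * δ
  have hgap : ∀ k, Integrable (fun ω => c ⬝ᵥ x k ω - F) P := fun k =>
    (hobj k).sub (integrable_const F)
  have h1 : ∫ ω, (c ⬝ᵥ x (k + 1) ω - F) ∂P ≤ ∫ ω, (c ⬝ᵥ x k ω - F) ∂P
      + (1 - εseq k) * ∫ ω, subValue A c (x k ω) (I k ω) ∂P := by
    rw [← integral_const_mul, ← integral_add (hgap k) (hI.const_mul _)]
    refine integral_mono_ae (hgap _) ((hgap k).add (hI.const_mul _)) ?_
    filter_upwards [h.ae_objective_step hnear hp] with ω hω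
    linarith [hω k]
  have h2 : ∫ ω, subValue A c (x k ω) (I k ω) ∂P
      ≤ v * ∫ ω, subValue A c (x k ω) Finset.univ ∂P := by
    rw [← integral_condExp (history_le h.measurable_x k), ← integral_const_mul]
    exact integral_mono_ae integrable_condExp ((hS _).const_mul v) (hv.2.2 k)
  have h3 : ∫ ω, subValue A c (x k ω) Finset.univ ∂P ≤ -∫ ω, (c ⬝ᵥ x k ω - F) ∂P := by
    rw [← integral_neg]
    refine integral_mono_ae (hS _) (hgap k).neg ?_
    filter_upwards [hnear] with ω hω
    linarith [subValue_univ_le_gap hκ hopt (hω k).2 (hω k).1]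
  have h4 : ∫ ω, subValue A c (x k ω) Finset.univ ∂P ≤ 0 := integral_nonpos_of_ae (by
    filter_upwards [hnear] with ω hω
    exact subValue_nonpos (hω k).2 hp _)
  have h5 := mul_le_mul_of_nonneg_left h2 (sub_nonneg.2 (hε1 k))
  -- Replacing `εseq k` by the larger `ε` weakens the bound because the mean subproblem value is
  -- nonpositive, whatever the sign of the gap.
  have h6 := mul_le_mul_of_nonpos_right (sub_le_sub_left (hεseq k) 1)
    (mul_nonpos_of_nonneg_of_nonpos hv.1.le h4)
  have h7 := mul_le_mul_of_nonneg_left h3 (mul_nonneg (sub_nonneg.2 hε) hv.1.le)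
  linarith

end Run

end InexactRBCD

theorem mainTheorem7 {M N : ℕ} (A : Matrix (Fin M) (Fin N) ℝ) (c : Fin N → ℝ) :
    ∃ κ : ℝ, 0 ≤ κ ∧
      (((InexactRBCD.dualFeasible A c).extremePoints ℝ).Nonempty →
        IsGreatest ((fun p => ‖p‖) '' (InexactRBCD.dualFeasible A c).extremePoints ℝ) κ) ∧
      ∀ (b : Fin M → ℝ) (xstar : Fin N → ℝ), xstar ∈ InexactRBCD.lpOptimal A b c →
      ∀ (l : ℕ) (δ ε : ℝ) (εseq εhat : ℕ → ℝ), 0 < δ → ε < 1 →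
      (∀ k, 0 ≤ εseq k ∧ εseq k ≤ ε) →
      (∀ k, 0 ≤ εhat k) → Summable εhat → ∑' k, εhat k ≤ δ →
      ∀ {Ω : Type*} [MeasurableSpace Ω] (P : Measure Ω) [IsProbabilityMeasure P]
        (x d : ℕ → Ω → Fin N → ℝ) (I : ℕ → Ω → Finset (Fin N)),
      InexactRBCD.IsRun A b c l εseq εhat P x d I →
        (∀ᵐ ω ∂P, ∀ k, ‖WithLp.toLp 2 (A *ᵥ x k ω - b)‖ ≤ δ ∧ 0 ≤ x k ω) ∧
        (∀ᵐ ω ∂P, ∀ k, c ⬝ᵥ xstar - κ * δ ≤ c ⬝ᵥ x k ω) ∧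
        InexactRBCD.ExpectedGSq A c P x I (1 / ((N.choose l : ℝ) * ((N : ℝ) - l + 1))) ∧
        ∀ v : ℝ, InexactRBCD.ExpectedGSq A c P x I v →
          ∀ k, Integrable (fun ω => c ⬝ᵥ x k ω) P ∧
            ∫ ω, (c ⬝ᵥ x k ω - (c ⬝ᵥ xstar + κ * δ)) ∂P ≤
              (1 - (1 - ε) * v) ^ k * ∫ ω, (c ⬝ᵥ x 0 ω - (c ⬝ᵥ xstar + κ * δ)) ∂P := by
  obtain ⟨κ, hκ0, hκmax, hκ⟩ := InexactRBCD.exists_extremePoint_bound A c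
  refine ⟨κ, hκ0, hκmax, fun b xstar hopt l δ ε εseq εhat _ hε hεseq hhat hsum hδ => ?_⟩
  intro Ω _ P _ x d I h
  have hnear := h.ae_near_feasible hhat hsum hδ
  have hε1 : ∀ k, εseq k ≤ 1 := fun k => (hεseq k).2.trans hε.le
  refine ⟨hnear, ?_, h.expectedGSq hκ hopt hε1 hnear, fun v hv k =>
    ⟨h.integrable_objective hκ hopt hε1 hnear k, ?_⟩⟩
  · filter_upwards [hnear] with ω hω k
    exact InexactRBCD.sub_le_objective hκ hopt (hω k).2 (hω k).1
  · have hε0 : 0 ≤ ε := (hεseq 0).1.trans (hεseq 0).2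
    -- The expected gap may be negative; iterating the recursion requires only a nonnegative factor.
    have hfac : 0 ≤ 1 - (1 - ε) * v :=
      sub_nonneg.2 (mul_le_one₀ (by linarith) hv.1.le hv.2.1)
    induction k with
    | zero => simp
    | succ k ih =>
      refine (h.integral_gap_succ_le hκ hopt hε.le (fun k => (hεseq k).2) hnear hv k).trans ?_
      rw [pow_succ', mul_assoc]
      exact mul_le_mul_of_nonneg_left ih hfac
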